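/- Let $A$ be an integral domain (commutative, with unit). An ideal $J$ of $A$ is called invertible if it has an inverse as a fractional ideal of $A$. We call $A$ an ISP-domain if every proper nonzero ideal $I$ of $A$ can be written as $I = JQ_1\cdots Q_n$, where $n \ge 1$, $J$ is an invertible ideal of $A$, and each $Q_i$ is a proper radical ideal of $A$. We call $A$ a Prüfer domain if every nonzero finitely generated ideal of $A$ is invertible. A Prüfer domain (in particular a valuation domain) is called strongly discrete if it has no idempotent prime ideal except zero. Fields are allowed as valuation domains, and "local" means having exactly one maximal ideal (no Noetherian hypothesis). Theorem. If $A$ is an ISP-domain, then (a) $A$ is a strongly discrete Prüfer domain, and (b) every nonzero prime ideal of $A$ is contained in a unique maximal ideal. In particular, a local domain is an ISP-domain if and only if it is a strongly discrete valuation domain. -/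

import Mathlib

open scoped nonZeroDivisors

/-- An ideal of a domain is invertible if, as a fractional ideal, it has an inverse. -/
def Ideal.IsInvertibleIdeal {A : Type*} [CommRing A] [IsDomain A] (J : Ideal A) : Prop :=
  IsUnit (J : FractionalIdeal A⁰ (FractionRing A))

/-- An ISP-domain (invertible semiprime domain): every proper nonzero ideal is an invertible
ideal times a nonempty finite product of proper radical ideals. -/
def IsISPDomain (A : Type*) [CommRing A] [IsDomain A] : Prop :=
  ∀ I : Ideal A, I ≠ ⊥ → I ≠ ⊤ →
    ∃ (J : Ideal A) (Q : List (Ideal A)), J.IsInvertibleIdeal ∧ Q ≠ [] ∧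
      (∀ H ∈ Q, H ≠ ⊤ ∧ H.IsRadical) ∧ I = J * Q.prod

/-- A Prüfer domain: every nonzero finitely generated ideal is invertible. -/
def IsPruferDomain (A : Type*) [CommRing A] [IsDomain A] : Prop :=
  ∀ I : Ideal A, I ≠ ⊥ → I.FG → I.IsInvertibleIdeal

/-- Strong discreteness: no prime ideal except zero is idempotent. -/
def IsStronglyDiscrete (A : Type*) [CommRing A] [IsDomain A] : Prop :=
  ∀ P : Ideal A, P.IsPrime → P * P = P → P = ⊥

/-! The ISP property passes to localizations, so (a) reduces to a local ring with maximal ideal `M`.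
If `M ≠ 0`, it is principal (`exists_maximalIdeal_eq_span`). When `M = (q)`, a proper radical ideal
`Q ≠ M` satisfies `Q = qQ`, so by Nakayama a nonzero finitely generated proper ideal is an
invertible ideal times a power of `M`. It is therefore principal, and the ring is a valuation ring.
For (b), primes above a common nonzero prime are comparable (`le_of_prime_le`). Conversely, proper
nonzero ideals of a strongly discrete valuation domain have the form `yP` with `P` prime. -/

namespace Ideal

/-! ### Invertible ideals -/

variable {A : Type*} [CommRing A] [IsDomain A]

theorem isInvertibleIdeal_iff_exists_mul_eq {J : Ideal A} :
    J.IsInvertibleIdeal ↔ ∃ (K : Ideal A) (x : A), x ≠ 0 ∧ J * K = span {x} := by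
  constructor
  · intro h
    obtain ⟨L, hL⟩ := isUnit_iff_exists_inv.mp h
    obtain ⟨a, K, ha, rfl⟩ := FractionalIdeal.exists_eq_spanSingleton_mul L
    refine ⟨K, a, ha, ?_⟩
    have ha' : algebraMap A (FractionRing A) a ≠ 0 := by simpa using ha
    apply FractionalIdeal.coeIdeal_injective (K := FractionRing A)
    beta_reduce
    rw [FractionalIdeal.coeIdeal_mul, FractionalIdeal.coeIdeal_span_singleton]
    calc (J : FractionalIdeal A⁰ (FractionRing A)) * K
        = FractionalIdeal.spanSingleton A⁰ (algebraMap A (FractionRing A) a) *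
          (J * (FractionalIdeal.spanSingleton A⁰ (algebraMap A (FractionRing A) a)⁻¹ * K)) := by
          rw [mul_left_comm (J : FractionalIdeal A⁰ (FractionRing A)), ← mul_assoc,
            FractionalIdeal.spanSingleton_mul_spanSingleton, mul_inv_cancel₀ ha',
            FractionalIdeal.spanSingleton_one, one_mul]
      _ = _ := by rw [hL, mul_one]
  · rintro ⟨K, x, hx, h⟩
    have hx' : algebraMap A (FractionRing A) x ≠ 0 := by simpa using hx
    have : IsUnit ((J : FractionalIdeal A⁰ (FractionRing A)) * K) := by
      rw [← FractionalIdeal.coeIdeal_mul, h, FractionalIdeal.coeIdeal_span_singleton]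
      refine IsUnit.of_mul_eq_one (FractionalIdeal.spanSingleton A⁰
        (algebraMap A (FractionRing A) x)⁻¹) ?_
      rw [FractionalIdeal.spanSingleton_mul_spanSingleton, mul_inv_cancel₀ hx',
        FractionalIdeal.spanSingleton_one]
    exact isUnit_of_mul_isUnit_left this

theorem isInvertibleIdeal_span_singleton {x : A} (hx : x ≠ 0) :
    (span {x}).IsInvertibleIdeal :=
  isInvertibleIdeal_iff_exists_mul_eq.mpr ⟨⊤, x, hx, mul_top _⟩

theorem IsInvertibleIdeal.le_of_mul_le_mul {J I K : Ideal A} (hJ : J.IsInvertibleIdeal)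
    (h : J * I ≤ J * K) : I ≤ K := by
  obtain ⟨L, x, hx, hL⟩ := isInvertibleIdeal_iff_exists_mul_eq.mp hJ
  have := mul_mono_right (I := L) h
  rw [← mul_assoc, ← mul_assoc, mul_comm L, hL] at this
  exact (span_singleton_mul_right_mono hx).mp this

theorem IsInvertibleIdeal.fg {J : Ideal A} (hJ : J.IsInvertibleIdeal) : J.FG :=
  J.fg_of_isUnit (IsFractionRing.injective A (FractionRing A)) hJ

theorem IsInvertibleIdeal.map {J : Ideal A} (hJ : J.IsInvertibleIdeal) {B : Type*} [CommRing B]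
    [IsDomain B] (f : A →+* B) (hf : Function.Injective f) : (J.map f).IsInvertibleIdeal := by
  obtain ⟨L, x, hx, hL⟩ := isInvertibleIdeal_iff_exists_mul_eq.mp hJ
  refine isInvertibleIdeal_iff_exists_mul_eq.mpr
    ⟨L.map f, f x, (map_ne_zero_iff f hf).mpr hx, ?_⟩
  rw [← Ideal.map_mul, hL, map_span, Set.image_singleton]

theorem map_list_prod {A B : Type*} [CommSemiring A] [CommSemiring B] (f : A →+* B)
    (Q : List (Ideal A)) :
    Q.prod.map f = (Q.map (Ideal.map f)).prod :=
  _root_.map_list_prod (Ideal.mapHom f) Q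

end Ideal

/-! ### Localization of ISP-domains -/

open Ideal IsLocalRing

theorem IsISPDomain.of_isLocalization {A : Type*} [CommRing A] [IsDomain A] (hA : IsISPDomain A)
    {S : Submonoid A} (hS : S ≤ A⁰) (B : Type*) [CommRing B] [IsDomain B] [Algebra A B]
    [IsLocalization S B] : IsISPDomain B := by
  classical
  intro I hI0 hI1
  have hinj : Function.Injective (algebraMap A B) := IsLocalization.injective B hS
  have hmc : (I.comap (algebraMap A B)).map (algebraMap A B) = I := IsLocalization.map_under S B I
  obtain ⟨J, Q, hJ, hQ0, hQ, h⟩ := hA (I.comap (algebraMap A B))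
    (by rintro h; rw [h, Ideal.map_bot] at hmc; exact hI0 hmc.symm)
    (comap_ne_top _ hI1)
  by_cases hne : ∃ H ∈ Q, H.map (algebraMap A B) ≠ ⊤
  · refine ⟨J.map (algebraMap A B), (Q.map (Ideal.map (algebraMap A B))).filter (· ≠ ⊤),
      hJ.map _ hinj, ?_, ?_, ?_⟩
    · obtain ⟨H, hH, hH'⟩ := hne
      exact List.ne_nil_of_mem (List.mem_filter.mpr ⟨List.mem_map_of_mem hH, by simpa using hH'⟩)
    · intro H hH
      rw [List.mem_filter, List.mem_map] at hH
      obtain ⟨⟨H', hH', rfl⟩, hne⟩ := hH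
      refine ⟨by simpa using hne, ?_⟩
      rw [← Ideal.radical_eq_iff, ← IsLocalization.map_radical S, (hQ _ hH').2.radical]
    · conv_lhs => rw [← hmc, h, Ideal.map_mul, Ideal.map_list_prod]
      congr 1
      generalize Q.map (Ideal.map (algebraMap A B)) = Q'
      induction Q' with
      | nil => rfl
      | cons a l ih => 
        by_cases ha : a = ⊤
        · simpa [ha, ← Ideal.one_eq_top] using ih
        · rw [List.filter_cons_of_pos (by simpa using ha), List.prod_cons, List.prod_cons, ih]
  -- If every factor became trivial, `J ≤ J * Q.prod` would follow, and cancelling `J` would make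
  -- `Q.prod` trivial.
  · push Not at hne
    exfalso
    have hmap : J.map (algebraMap A B) = I := by
      rw [← hmc, h, Ideal.map_mul, Ideal.map_list_prod, List.map_congr_left hne]
      simp [← Ideal.one_eq_top]
    have hle : J * ⊤ ≤ J * Q.prod := by
      rw [← h, ← hmap, mul_top]
      exact le_comap_map
    have htop := top_le_iff.mp (hJ.le_of_mul_le_mul hle)
    obtain ⟨H, hH⟩ := List.exists_mem_of_ne_nil Q hQ0
    refine (hQ H hH).1 (top_le_iff.mp (htop ▸ ?_))
    exact Ideal.le_of_dvd (List.dvd_prod hH)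

/-! ### Local ISP-domains: the maximal ideal is principal -/

namespace IsISPDomain

section Local

variable {A : Type*} [CommRing A] [IsDomain A]

/-- In the local domain `A/P`, a factor of a nonzero principal ideal is invertible, hence principal;
`r` generates a radical factor. -/
theorem exists_isRadical_sup [IsLocalRing A] (hA : IsISPDomain A) {P : Ideal A} [hP : P.IsPrime]
    (hPM : P ≠ maximalIdeal A) :
    ∃ r ∈ maximalIdeal A, r ∉ P ∧ (span {r} ⊔ P).IsRadical := by
  obtain ⟨x, hxM, hxP⟩ := SetLike.exists_of_lt
    (lt_of_le_of_ne (le_maximalIdeal hP.ne_top) hPM)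
  have hle : span {x} ⊔ P ≤ maximalIdeal A :=
    sup_le ((span_singleton_le_iff_mem _).mpr hxM) (le_maximalIdeal hP.ne_top)
  have hxI : x ∈ span {x} ⊔ P := mem_sup_left (mem_span_singleton_self x)
  obtain ⟨J, Q, -, hQ0, hQ, h⟩ := hA (span {x} ⊔ P)
    (fun h0 => hxP (by rw [h0, mem_bot] at hxI; rw [hxI]; exact P.zero_mem))
    (fun h1 => (maximalIdeal.isMaximal A).ne_top (top_le_iff.mp (h1 ▸ hle)))
  obtain _ | ⟨H, Q⟩ := Q
  · exact absurd rfl hQ0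
  rw [List.prod_cons, mul_left_comm] at h
  obtain ⟨hHtop, hHrad⟩ := hQ H List.mem_cons_self
  -- Otherwise `x` would lie in `Mx + P`, hence in `P`.
  have key : ∃ a ∈ H, ∃ b ∈ J * Q.prod, ∃ c : A, IsUnit c ∧ a * b - c * x ∈ P := by
    by_contra! hcon
    have : H * (J * Q.prod) ≤ maximalIdeal A * span {x} ⊔ P := by
      rw [mul_le]
      intro a ha b hb
      have hab : a * b ∈ span {x} ⊔ P := h ▸ mul_mem_mul ha hb
      obtain ⟨y, hy, p, hp, hyp⟩ := Submodule.mem_sup.mp hab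
      obtain ⟨c, rfl⟩ := mem_span_singleton'.mp hy
      refine hyp ▸ Submodule.add_mem_sup (mul_mem_mul ?_ (mem_span_singleton_self x)) hp
      rw [mem_maximalIdeal, mem_nonunits_iff]
      intro hc
      exact hcon a ha b hb c hc (by rw [← hyp]; simpa using hp)
    obtain ⟨y, hy, p, hp, hyp⟩ := Submodule.mem_sup.mp (this (h ▸ hxI))
    obtain ⟨m, hm, rfl⟩ := mem_mul_span_singleton.mp hy
    have hu : IsUnit (1 - m) := (isUnit_or_isUnit_one_sub_self m).resolve_left hm
    refine hxP ((P.unit_mul_mem_iff_mem hu).mp ?_)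
    have : (1 - m) * x = p := by linear_combination - hyp
    rwa [this]
  obtain ⟨a, ha, b, hb, c, hc, habc⟩ := key
  have hcx : c * x ∉ P := fun h => hxP ((P.unit_mul_mem_iff_mem hc).mp h)
  have hab : a * b ∉ P := fun h => hcx (by simpa using P.sub_mem h habc)
  have hPH : P ≤ H := le_sup_right.trans (h.trans_le mul_le_left)
  refine ⟨a, le_maximalIdeal hHtop ha, fun h => hab (P.mul_mem_right _ h), ?_⟩
  suffices hH : H = span {a} ⊔ P from hH ▸ hHrad
  refine le_antisymm (fun z hz => ?_) (sup_le ((span_singleton_le_iff_mem _).mpr ha) hPH)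
  have hzb : z * b ∈ span {x} ⊔ P := h ▸ mul_mem_mul hz hb
  obtain ⟨y, hy, p, hp, hyp⟩ := Submodule.mem_sup.mp hzb
  obtain ⟨d, rfl⟩ := mem_span_singleton'.mp hy
  obtain ⟨e, he⟩ := hc.exists_right_inv
  have hmem : b * (z - d * e * a) ∈ P := by
    have : b * (z - d * e * a) = p - d * e * (a * b - c * x) := by
      linear_combination - hyp - d * x * he
    rw [this]
    exact P.sub_mem hp (P.mul_mem_left _ habc)
  have hz' := (hP.mem_or_mem hmem).resolve_left fun h => hab (P.mul_mem_left _ h)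
  rw [← add_sub_cancel (d * e * a) z]
  exact Submodule.add_mem_sup (mem_span_singleton'.mpr ⟨_, rfl⟩) hz'

/-- Since `r ∉ M²`, the ideal `(r, x²)` is not a product of two proper ideals, so it is radical and
contains `x`; then `x = cx²` modulo `r`, with `1 - cx` a unit. -/
theorem prime_le_span_singleton [IsLocalRing A] (hA : IsISPDomain A) {P : Ideal A}
    [P.IsPrime] {r : A} (hr : r ∉ P) (hM : maximalIdeal A = span {r} ⊔ P) :
    P ≤ span {r} := by
  intro x hx
  have hrM : r ∈ maximalIdeal A := hM ▸ mem_sup_left (mem_span_singleton_self r)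
  have hxM : x ∈ maximalIdeal A := hM ▸ mem_sup_right hx
  have hr2 : r ∉ maximalIdeal A * maximalIdeal A := by
    intro h
    have hle : maximalIdeal A * maximalIdeal A ≤ span {r * r} ⊔ P := by
      conv_lhs => rw [hM, Ideal.sup_mul, Ideal.mul_sup, span_singleton_mul_span_singleton]
      exact sup_le (sup_le le_sup_left (Ideal.mul_le_right.trans le_sup_right))
        (Ideal.mul_le_left.trans le_sup_right)
    obtain ⟨y, hy, p, hp, hyp⟩ := Submodule.mem_sup.mp (hle h)
    obtain ⟨c, rfl⟩ := mem_span_singleton'.mp hy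
    have hu : IsUnit (1 - c * r) :=
      (isUnit_or_isUnit_one_sub_self (c * r)).resolve_left
        ((maximalIdeal A).mul_mem_left c hrM)
    refine hr ((P.unit_mul_mem_iff_mem hu).mp ?_)
    have : (1 - c * r) * r = p := by linear_combination - hyp
    rwa [this]
  have hI : span {r} ⊔ span {x ^ 2} ≤ maximalIdeal A :=
    sup_le ((span_singleton_le_iff_mem _).mpr hrM)
      ((span_singleton_le_iff_mem _).mpr (Ideal.pow_mem_of_mem _ hxM 2 two_pos))
  have hrI : r ∈ span {r} ⊔ span {x ^ 2} := mem_sup_left (mem_span_singleton_self r)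
  obtain ⟨J, Q, -, hQ0, hQ, h⟩ := hA (span {r} ⊔ span {x ^ 2})
    (fun h0 => hr (by rw [h0, mem_bot] at hrI; rw [hrI]; exact P.zero_mem))
    (fun h1 => (maximalIdeal.isMaximal A).ne_top (top_le_iff.mp (h1 ▸ hI)))
  obtain _ | ⟨H, Q⟩ := Q
  · exact absurd rfl hQ0
  rw [List.prod_cons, mul_left_comm] at h
  obtain ⟨hHtop, hHrad⟩ := hQ H List.mem_cons_self
  have hJQ : J * Q.prod = ⊤ := by
    by_contra hne
    exact hr2 (mul_mono (le_maximalIdeal hHtop) (le_maximalIdeal hne) (h ▸ hrI))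
  rw [hJQ, mul_top] at h
  have hxI : x ∈ span {r} ⊔ span {x ^ 2} :=
    h ▸ hHrad ⟨2, h ▸ mem_sup_right (mem_span_singleton_self _)⟩
  obtain ⟨y, hy, z, hz, hyz⟩ := Submodule.mem_sup.mp hxI
  obtain ⟨c, rfl⟩ := mem_span_singleton'.mp hz
  have hu : IsUnit (1 - c * x) :=
    (isUnit_or_isUnit_one_sub_self (c * x)).resolve_left ((maximalIdeal A).mul_mem_left c hxM)
  refine ((span {r}).unit_mul_mem_iff_mem hu).mp ?_
  have : (1 - c * x) * x = y := by linear_combination - hyz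
  rwa [this]

/-- Otherwise `q` lies in a prime `P ≠ M`. Localizing at a prime minimal over a radical `(r) + P`
makes that ideal maximal, so `P ⊆ (r)` there. Then `q = zr`, `z = z'r` and `z² = z'q`, so `q ∣ z`
and `r` is a unit. -/
theorem maximalIdeal_eq_span_of_isRadical [IsLocalRing A] (hA : IsISPDomain A) {q : A}
    (hq0 : q ≠ 0) (hqM : q ∈ maximalIdeal A) (hq : (span {q}).IsRadical) :
    maximalIdeal A = span {q} := by
  refine le_antisymm (fun x hxM => ?_) ((span_singleton_le_iff_mem _).mpr hqM)
  by_contra hx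
  rw [← hq.radical, radical_eq_sInf, mem_sInf] at hx
  push Not at hx
  obtain ⟨P, ⟨hqP, hP⟩, hxP⟩ := hx
  rw [span_singleton_le_iff_mem] at hqP
  obtain ⟨r, hrM, hrP, hr⟩ := hA.exists_isRadical_sup (P := P) (fun h => hxP (h ▸ hxM))
  have hle : span {r} ⊔ P ≤ maximalIdeal A :=
    sup_le ((span_singleton_le_iff_mem _).mpr hrM) (le_maximalIdeal hP.ne_top)
  obtain ⟨N, hN, -⟩ := exists_minimalPrimes_le hle
  have hNp : N.IsPrime := hN.1.1
  have hPN : P ≤ N := le_sup_right.trans hN.1.2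
  let B := Localization.AtPrime N
  have hB : IsISPDomain B := hA.of_isLocalization N.primeCompl_le_nonZeroDivisors B
  have hPd : Disjoint (N.primeCompl : Set A) (P : Set A) :=
    Set.disjoint_left.mpr fun a ha haP => ha (hPN haP)
  have hPB : (P.map (algebraMap A B)).IsPrime :=
    IsLocalization.isPrime_of_isPrime_disjoint N.primeCompl B P hP hPd
  have hmap : maximalIdeal B = span {algebraMap A B r} ⊔ P.map (algebraMap A B) := by
    rw [← Set.image_singleton, ← map_span, ← Ideal.map_sup, ← hr.radical,
      IsLocalization.map_radical N.primeCompl,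
      IsLocalization.AtPrime.radical_map_of_mem_minimalPrimes B N _ hN,
      Localization.AtPrime.map_eq_maximalIdeal]
  have hrB : algebraMap A B r ∉ P.map (algebraMap A B) := by
    intro h
    have := IsLocalization.under_map_of_isPrime_disjoint N.primeCompl B hP hPd
    exact hrP (this ▸ h)
  have hle := hB.prime_le_span_singleton hrB hmap
  have hrad : (span {algebraMap A B q}).IsRadical := by
    rw [← Set.image_singleton, ← map_span, ← Ideal.radical_eq_iff,
      ← IsLocalization.map_radical N.primeCompl, hq.radical]
  have hrmax : algebraMap A B r ∈ maximalIdeal B :=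
    hmap ▸ mem_sup_left (mem_span_singleton_self _)
  have hqB : algebraMap A B q ∈ P.map (algebraMap A B) := mem_map_of_mem _ hqP
  obtain ⟨z, hz⟩ := mem_span_singleton'.mp (hle hqB)
  have hzP : z ∈ P.map (algebraMap A B) :=
    (hPB.mem_or_mem (hz ▸ hqB)).resolve_right hrB
  obtain ⟨z', hz'⟩ := mem_span_singleton'.mp (hle hzP)
  have hmem : z ∈ span {algebraMap A B q} :=
    hrad ⟨2, mem_span_singleton'.mpr ⟨z', by rw [← hz, ← hz']; ring⟩⟩
  obtain ⟨t, ht⟩ := mem_span_singleton'.mp hmem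
  have hqB0 : algebraMap A B q ≠ 0 :=
    (map_ne_zero_iff _ (IsLocalization.injective B N.primeCompl_le_nonZeroDivisors)).mpr hq0
  refine hrmax (IsUnit.of_mul_eq_one t (mul_left_cancel₀ hqB0 ?_))
  linear_combination algebraMap A B r * ht + hz

theorem exists_maximalIdeal_eq_span [IsLocalRing A] (hA : IsISPDomain A)
    (hF : maximalIdeal A ≠ ⊥) : ∃ q : A, q ≠ 0 ∧ maximalIdeal A = span {q} := by
  obtain ⟨q, hqM, hq0, hq⟩ := hA.exists_isRadical_sup (P := ⊥) hF.symm
  rw [sup_bot_eq] at hq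
  exact ⟨q, hq0, hA.maximalIdeal_eq_span_of_isRadical hq0 hqM hq⟩

end Local

end IsISPDomain

/-! ### Local ISP-domains are valuation rings -/

/-- As `q ∉ Q`, an element of `Q` has the form `wq²`; then `(wq)² ∈ Q` gives `wq ∈ Q`. -/
theorem Ideal.IsRadical.le_span_mul {A : Type*} [CommRing A] [IsLocalRing A] {Q : Ideal A}
    (hQ : Q.IsRadical) (hQ1 : Q ≠ ⊤) {q : A} (hq : maximalIdeal A = span {q})
    (hQM : Q ≠ maximalIdeal A) : Q ≤ span {q} * Q := by
  have hQle := le_maximalIdeal hQ1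
  have hqQ : q ∉ Q := fun h =>
    hQM (le_antisymm hQle (hq ▸ (span_singleton_le_iff_mem _).mpr h))
  intro x hx
  obtain ⟨z, rfl⟩ := mem_span_singleton'.mp (hq ▸ hQle hx)
  have hz : z ∈ maximalIdeal A := fun hu => hqQ ((Q.unit_mul_mem_iff_mem hu).mp hx)
  rw [hq] at hz
  obtain ⟨w, rfl⟩ := mem_span_singleton'.mp hz
  have : w * q ∈ Q := hQ ⟨2, by rw [show (w * q) ^ 2 = w * (w * q * q) by ring]
                                exact Q.mul_mem_left _ hx⟩
  rw [mul_comm _ q]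
  exact mul_mem_mul (mem_span_singleton_self q) this

/-- In a local ring with principal maximal ideal, the radical factors of a finitely generated
ideal are trivial or maximal. -/
theorem Ideal.eq_maximalIdeal_of_mul_list_prod_fg {A : Type*} [CommRing A] [IsDomain A]
    [IsLocalRing A] {q : A} (hq : maximalIdeal A = span {q}) {J : Ideal A} {Q : List (Ideal A)}
    (hfg : (J * Q.prod).FG) (h0 : J * Q.prod ≠ ⊥) {H : Ideal A} (hH : H ∈ Q)
    (hr : H.IsRadical) (h1 : H ≠ ⊤) : H = maximalIdeal A := by
  classical
  by_contra hne
  refine h0 (Submodule.eq_bot_of_le_smul_of_le_jacobson_bot (span {q}) _ hfg ?_ ?_)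
  · rw [smul_eq_mul, (List.perm_cons_erase hH).prod_eq, List.prod_cons, mul_left_comm,
      ← mul_assoc (span {q})]
    exact mul_mono_left (hr.le_span_mul h1 hq hne)
  · rw [← hq, IsLocalRing.jacobson_eq_maximalIdeal _ bot_ne_top]

theorem IsISPDomain.isPrincipal_of_fg {A : Type*} [CommRing A] [IsDomain A] [IsLocalRing A]
    (hA : IsISPDomain A) {I : Ideal A} (hI : I.FG) : I.IsPrincipal := by
  by_cases h0 : I = ⊥
  · exact h0 ▸ bot_isPrincipal
  by_cases h1 : I = ⊤
  · exact h1 ▸ top_isPrincipal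
  obtain ⟨q, -, hq⟩ := hA.exists_maximalIdeal_eq_span fun h =>
    h0 (le_bot_iff.mp (h ▸ le_maximalIdeal h1))
  obtain ⟨J, Q, hJ, -, hQ, rfl⟩ := hA I h0 h1
  have hQM : ∀ H ∈ Q, H = maximalIdeal A := fun H hH =>
    eq_maximalIdeal_of_mul_list_prod_fg hq hI h0 hH (hQ H hH).2 (hQ H hH).1
  obtain ⟨⟨a, rfl⟩⟩ : J.IsPrincipal :=
    Ideal.IsPrincipal.of_finite_maximals_of_isUnit
      ((Set.finite_singleton (maximalIdeal A)).subset fun _ h => eq_maximalIdeal h) hJ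
  rw [List.eq_replicate_of_mem hQM, List.prod_replicate, hq, span_singleton_pow,
    submodule_span_eq, span_singleton_mul_span_singleton]
  exact ⟨⟨_, rfl⟩⟩

theorem IsISPDomain.valuationRing {A : Type*} [CommRing A] [IsDomain A] [IsLocalRing A]
    (hA : IsISPDomain A) : ValuationRing A :=
  ValuationRing.iff_local_bezout_domain.mpr ⟨inferInstance, ⟨fun _ => hA.isPrincipal_of_fg⟩⟩

/-! ### From local to global: Prüfer and strongly discrete -/

theorem IsISPDomain.localizationAtPrime {A : Type*} [CommRing A] [IsDomain A]
    (hA : IsISPDomain A) (P : Ideal A) [P.IsPrime] : IsISPDomain (Localization.AtPrime P) :=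
  hA.of_isLocalization P.primeCompl_le_nonZeroDivisors _

/-- A finitely generated ideal that is principal at every maximal ideal is invertible. -/
theorem Ideal.isInvertibleIdeal_of_forall_isMaximal {A : Type*} [CommRing A] [IsDomain A]
    {I : Ideal A} (hI : I ≠ ⊥)
    (h : ∀ M : Ideal A, M.IsMaximal → ∃ a ∈ I, ∃ s ∉ M, ∀ x ∈ I, s * x ∈ span {a}) :
    I.IsInvertibleIdeal := by
  obtain ⟨b, hbI, hb⟩ := Submodule.exists_mem_ne_zero_of_ne_bot hI
  refine isInvertibleIdeal_iff_exists_mul_eq.mpr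
    ⟨(span {b}).colon (I : Set A), b, hb, le_antisymm ?_ ?_⟩
  · rw [mul_comm, mul_le]
    intro x hx y hy
    exact Submodule.mem_colon.mp hx y hy
  · rw [span_singleton_le_iff_mem]
    -- This ideal lies in no maximal `M`: `s * b = a * c`, where `c` carries `I` into `(b)`.
    have htop : (I * (span {b}).colon (I : Set A)).colon {b} = ⊤ := by
      by_contra hne
      obtain ⟨M, hM, hle⟩ := exists_le_maximal _ hne
      obtain ⟨a, haI, s, hs, hsI⟩ := h M hM
      obtain ⟨c, hc⟩ := mem_span_singleton'.mp (hsI b hbI)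
      refine hs (hle (Submodule.mem_colon_singleton.mpr ?_))
      rw [smul_eq_mul, ← hc, mul_comm c a]
      refine mul_mem_mul haI (Submodule.mem_colon.mpr fun x hx => ?_)
      obtain ⟨d, hd⟩ := mem_span_singleton'.mp (hsI x hx)
      have ha0 : a ≠ 0 := by
        rintro rfl
        rw [mul_zero, eq_comm, mul_eq_zero] at hc
        exact hs (hc.resolve_right hb ▸ M.zero_mem)
      refine mem_span_singleton'.mpr ⟨d, mul_left_cancel₀ ha0 ?_⟩
      rw [smul_eq_mul]
      linear_combination b * hd - x * hc
    have := htop ▸ Submodule.mem_top (x := (1 : A))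
    simpa using Submodule.mem_colon_singleton.mp this

theorem IsISPDomain.isPruferDomain {A : Type*} [CommRing A] [IsDomain A]
    (hA : IsISPDomain A) : IsPruferDomain A := by
  intro I hI hfg
  refine isInvertibleIdeal_of_forall_isMaximal hI fun M hM => ?_
  let B := Localization.AtPrime M
  obtain ⟨g, hg⟩ := ((hA.localizationAtPrime M).isPrincipal_of_fg
    (hfg.map (algebraMap A B))).principal
  rw [submodule_span_eq] at hg
  obtain ⟨⟨⟨a, ha⟩, s⟩, hs⟩ := (IsLocalization.mem_map_algebraMap_iff M.primeCompl B).mp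
    (hg.symm ▸ mem_span_singleton_self g : g ∈ I.map (algebraMap A B))
  have hmap : I.map (algebraMap A B) = (span {a}).map (algebraMap A B) := by
    rw [hg, map_span, Set.image_singleton, ← hs,
      span_singleton_mul_right_unit (IsLocalization.map_units B s)]
  have hx : ∀ x ∈ I, ∃ t ∈ M.primeCompl, t * x ∈ span {a} := fun x hx =>
    (IsLocalization.algebraMap_mem_map_algebraMap_iff M.primeCompl B _ x).mp
      (hmap ▸ mem_map_of_mem _ hx)
  obtain ⟨T, rfl⟩ := hfg
  choose! t ht hta using hx
  refine ⟨a, ha, ∏ x ∈ T, t x,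
    (prod_mem fun x hx => ht x (subset_span hx) : _ ∈ M.primeCompl), fun x hx => ?_⟩
  have : span (T : Set A) ≤ (span {a}).colon {∏ x ∈ T, t x} := by
    refine span_le.mpr fun y hy => Submodule.mem_colon_singleton.mpr ?_
    obtain ⟨c, hc⟩ := Finset.dvd_prod_of_mem t hy
    rw [smul_eq_mul, hc, show y * (t y * c) = c * (t y * y) by ring]
    exact Ideal.mul_mem_left _ _ (hta y (subset_span hy))
  rw [mul_comm]
  exact Submodule.mem_colon_singleton.mp (this hx)

theorem IsISPDomain.isStronglyDiscrete {A : Type*} [CommRing A] [IsDomain A]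
    (hA : IsISPDomain A) : IsStronglyDiscrete A := by
  intro P hP hPP
  by_contra h0
  let B := Localization.AtPrime P
  have hinj : Function.Injective (algebraMap A B) :=
    IsLocalization.injective B P.primeCompl_le_nonZeroDivisors
  have hmap : P.map (algebraMap A B) = maximalIdeal B := Localization.AtPrime.map_eq_maximalIdeal
  obtain ⟨q, hq0, hq⟩ := (hA.localizationAtPrime P).exists_maximalIdeal_eq_span
    (by rwa [← hmap, Ne, map_eq_bot_iff_of_injective hinj])
  have h1 : maximalIdeal B * maximalIdeal B = maximalIdeal B := by
    rw [← hmap, ← Ideal.map_mul, hPP]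
  have hqM : q ∈ maximalIdeal B := hq ▸ mem_span_singleton_self q
  have hmem := hqM
  rw [← h1, hq, span_singleton_mul_span_singleton] at hmem
  obtain ⟨c, hc⟩ := mem_span_singleton'.mp hmem
  refine hqM (IsUnit.of_mul_eq_one c (mul_left_cancel₀ hq0 ?_))
  linear_combination hc

/-! ### Comparability of primes above a nonzero prime -/

/-- At a prime where the localization is a valuation ring, elements outside a prime `P` divide
the elements of `P`. -/
theorem Ideal.exists_mul_eq_mul_of_mem_prime {A : Type*} [CommRing A] [IsDomain A] {N : Ideal A}
    [N.IsPrime] [ValuationRing (Localization.AtPrime N)] {P : Ideal A} (hP : P.IsPrime)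
    (hPN : P ≤ N) {z t : A} (hz : z ∈ P) (ht : t ∉ P) : ∃ u ∉ N, ∃ w, u * z = t * w := by
  have key : ∀ a b : A, algebraMap A (Localization.AtPrime N) a ∣ algebraMap A _ b →
      ∃ u ∉ N, ∃ w, u * b = a * w := by
    intro a b hab
    have := mem_span_singleton.mpr hab
    rw [← Set.image_singleton, ← map_span,
      IsLocalization.algebraMap_mem_map_algebraMap_iff N.primeCompl] at this
    obtain ⟨u, hu, hub⟩ := this
    obtain ⟨w, hw⟩ := mem_span_singleton'.mp hub
    exact ⟨u, hu, w, by rw [← hw, mul_comm]⟩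
  obtain h | h := ValuationRing.dvd_total (algebraMap A (Localization.AtPrime N) t)
    (algebraMap A _ z)
  · exact key t z h
  · obtain ⟨u, hu, w, huw⟩ := key z t h
    have : u * t ∈ P := huw ▸ P.mul_mem_right w hz
    exact absurd this fun h => (hP.mem_or_mem h).elim (fun h => hu (hPN h)) ht

/-- Take `0 ≠ x ∈ P`, `t ∈ N \ M`, and factor `I = xA_M ∩ A`. At `N`, `I = tI`, because `t ∉ P` and
`t` is a unit at `M`. This forces `J = tJ` at `N`, absurd for `J` invertible. -/
theorem IsISPDomain.le_of_prime_le {A : Type*} [CommRing A] [IsDomain A] (hA : IsISPDomain A)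
    {P M N : Ideal A} (hP : P.IsPrime) (hP0 : P ≠ ⊥) (hM : M.IsPrime) (hN : N.IsPrime)
    (hPM : P ≤ M) (hPN : P ≤ N) : M ≤ N ∨ N ≤ M := by
  by_contra! hcon
  obtain ⟨hMN, hNM⟩ := hcon
  obtain ⟨m, hmM, hmN⟩ := SetLike.not_le_iff_exists.mp hMN
  obtain ⟨t, htN, htM⟩ := SetLike.not_le_iff_exists.mp hNM
  obtain ⟨x, hxP, hx0⟩ := Submodule.exists_mem_ne_zero_of_ne_bot hP0
  let B := Localization.AtPrime M
  have hinj : Function.Injective (algebraMap A B) :=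
    IsLocalization.injective B M.primeCompl_le_nonZeroDivisors
  set I := ((span {x}).map (algebraMap A B)).comap (algebraMap A B)
  have memI : ∀ z, z ∈ I ↔ ∃ s ∈ M.primeCompl, s * z ∈ span {x} := fun z =>
    IsLocalization.algebraMap_mem_map_algebraMap_iff M.primeCompl B _ z
  have hIP : I ≤ P := by
    intro z hz
    obtain ⟨s, hs, hsz⟩ := (memI z).mp hz
    exact (hP.mem_or_mem ((span_singleton_le_iff_mem _).mpr hxP hsz)).resolve_left
      fun h => hs (hPM h)
  have hxI : x ∈ I := le_comap_map (mem_span_singleton_self x)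
  obtain ⟨J, Q, hJ, -, hQ, h⟩ := hA I
    (fun h0 => hx0 (by rwa [h0, mem_bot] at hxI))
    (fun h1 => hP.ne_top (top_le_iff.mp (h1 ▸ hIP)))
  have hmap : J.map (algebraMap A B) * (Q.map (Ideal.map (algebraMap A B))).prod =
      (span {x}).map (algebraMap A B) := by
    rw [← Ideal.map_list_prod, ← Ideal.map_mul, ← h]
    exact IsLocalization.map_under M.primeCompl B _
  obtain ⟨q, -, hq⟩ := (hA.localizationAtPrime M).exists_maximalIdeal_eq_span (by
    rw [← Localization.AtPrime.map_eq_maximalIdeal, Ne, map_eq_bot_iff_of_injective hinj]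
    exact fun h => hP0 (le_bot_iff.mp (h ▸ hPM)))
  have hfac : ∀ H ∈ Q, ∃ s ∉ M, s * m ∈ H := by
    intro H hH
    have hrad : (H.map (algebraMap A B)).IsRadical := by
      rw [← Ideal.radical_eq_iff, ← IsLocalization.map_radical M.primeCompl, (hQ H hH).2.radical]
    have hle : maximalIdeal B ≤ H.map (algebraMap A B) := by
      by_cases htop : H.map (algebraMap A B) = ⊤
      · exact htop ▸ le_top
      refine (eq_maximalIdeal_of_mul_list_prod_fg hq (J := J.map (algebraMap A B)) ?_ ?_
        (List.mem_map_of_mem hH) hrad htop).ge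
      · rw [hmap, map_span, Set.image_singleton]
        exact ⟨{algebraMap A B x}, by rw [Finset.coe_singleton]⟩
      · rw [hmap, Ne, map_eq_bot_iff_of_injective hinj, span_singleton_eq_bot]
        exact hx0
    have hm : algebraMap A B m ∈ maximalIdeal B := by
      rw [← Localization.AtPrime.map_eq_maximalIdeal]
      exact mem_map_of_mem _ hmM
    exact (IsLocalization.algebraMap_mem_map_algebraMap_iff M.primeCompl B _ m).mp (hle hm)
  -- Each factor is trivial or maximal at `M`; `v` is a power of `m`.
  have hprod : ∃ s ∉ M, ∃ v ∉ N, s * v ∈ Q.prod := by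
    clear hQ h hmap
    induction Q with
    | nil => exact ⟨1, M.one_notMem, 1, N.one_notMem, by simp⟩
    | cons H Q ih =>
      obtain ⟨s, hs, v, hv, hsv⟩ := ih fun H' hH' => hfac H' (List.mem_cons_of_mem _ hH')
      obtain ⟨s', hs', hsm⟩ := hfac H List.mem_cons_self
      refine ⟨s' * s, fun h => (hM.mem_or_mem h).elim hs' hs, m * v,
        fun h => (hN.mem_or_mem h).elim hmN hv, ?_⟩
      rw [List.prod_cons, mul_mul_mul_comm]
      exact mul_mem_mul hsm hsv
  obtain ⟨s, hs, v, hv, hsv⟩ := hprod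
  have hs0 : s ≠ 0 := fun h => hs (h ▸ M.zero_mem)
  have hstM : s * t ∉ M := fun h => (hM.mem_or_mem h).elim hs htM
  have : ValuationRing (Localization.AtPrime N) := (hA.localizationAtPrime N).valuationRing
  have hIJ : I ≤ J := h ▸ Ideal.mul_le_left
  have hdvd : ∀ j ∈ J, ∃ u ∉ N, u * j ∈ span {t} * J := by
    intro j hj
    have hjI : j * (s * v) ∈ I := h ▸ mul_mem_mul hj hsv
    -- Dividing by `s * t` allows `s`, which may lie in `N`, to be cancelled later.
    obtain ⟨u, hu, w, huw⟩ := exists_mul_eq_mul_of_mem_prime hP hPN (hIP hjI) fun h => hstM (hPM h)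
    have hwI : w ∈ I := by
      obtain ⟨c, hc, hcw⟩ := (memI _).mp (huw ▸ I.mul_mem_left u hjI : s * t * w ∈ I)
      exact (memI w).mpr ⟨c * (s * t), M.primeCompl.mul_mem hc hstM, by rwa [mul_assoc]⟩
    refine ⟨u * v, fun h => (hN.mem_or_mem h).elim hu hv, ?_⟩
    have : u * v * j = t * w := mul_left_cancel₀ hs0 (by linear_combination huw)
    exact this ▸ mul_mem_mul (mem_span_singleton_self t) (hIJ hwI)
  obtain ⟨T, hT⟩ := hJ.fg
  choose! u hu hut using hdvd
  have hTJ : ∀ y ∈ T, y ∈ J := fun y hy => hT ▸ subset_span hy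
  have hle : J * span {∏ y ∈ T, u y} ≤ J * span {t} := by
    rw [mul_comm J (span {t}), mul_comm J, span_singleton_mul_le_iff]
    have : J ≤ (span {t} * J).colon {∏ y ∈ T, u y} := by
      conv_lhs => rw [← hT]
      refine span_le.mpr fun y hy => Submodule.mem_colon_singleton.mpr ?_
      obtain ⟨c, hc⟩ := Finset.dvd_prod_of_mem u hy
      rw [smul_eq_mul, hc, show y * (u y * c) = c * (u y * y) by ring]
      exact Ideal.mul_mem_left _ _ (hut y (hTJ y hy))
    intro z hz
    rw [mul_comm _ z]
    exact Submodule.mem_colon_singleton.mp (this hz)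
  have hmem := hJ.le_of_mul_le_mul hle (mem_span_singleton_self _)
  exact (prod_mem fun y hy => hu y (hTJ y hy) : ∏ y ∈ T, u y ∈ N.primeCompl)
    ((span_singleton_le_iff_mem _).mpr htN hmem)

/-! ### Ideals of strongly discrete valuation domains -/

/-- The prime is `P = {a | aI ≠ I}`. For `p ∈ P \ P²` and `x ∈ I \ pI`, either `x = py` and `I =
yP`, or `p ∈ I` and `I = P`. -/
theorem ValuationRing.exists_eq_span_singleton_mul_prime {A : Type*} [CommRing A] [IsDomain A]
    [ValuationRing A] (hA : IsStronglyDiscrete A) {I : Ideal A} (h0 : I ≠ ⊥) (h1 : I ≠ ⊤) :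
    ∃ (y : A) (P : Ideal A), y ≠ 0 ∧ P.IsPrime ∧ I = span {y} * P := by
  have hlt : ∀ {a}, a ≠ 0 → a ∈ I → ¬ I ≤ span {a} * I := fun {a} ha haI hle => by
    obtain ⟨z, hz, hza⟩ := mem_span_singleton_mul.mp (hle haI)
    have : z = 1 := mul_left_cancel₀ ha (by rw [hza, mul_one])
    exact h1 ((eq_top_iff_one I).mpr (this ▸ hz))
  have hmono : ∀ {a b : A}, a ∣ b → I ≤ span {b} * I → I ≤ span {a} * I := fun hab hle =>
    hle.trans (mul_mono_left (span_singleton_le_span_singleton.mpr hab))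
  let P : Ideal A :=
    { carrier := {a | ¬ I ≤ span {a} * I}
      zero_mem' := by simpa using h0
      add_mem' := by
        intro a b ha hb hab
        obtain h | h := ValuationRing.dvd_total a b
        · exact ha (hmono (dvd_add dvd_rfl h) hab)
        · exact hb (hmono (dvd_add h dvd_rfl) hab)
      smul_mem' := fun c a ha hca => ha (hmono (dvd_mul_left a c) hca) }
  have memP : ∀ a, a ∈ P ↔ ¬ I ≤ span {a} * I := fun a => Iff.rfl
  have notP : ∀ {a}, a ∉ P → ∀ x ∈ I, ∃ z ∈ I, a * z = x := fun {a} ha x hx =>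
    mem_span_singleton_mul.mp (not_not.mp ha hx)
  have hP : P.IsPrime := by
    refine ⟨(ne_top_iff_one P).mpr fun h => h (by simp), fun {a b} hab => ?_⟩
    by_contra! hcon
    refine hab fun x hx => ?_
    obtain ⟨y, hy, rfl⟩ := notP hcon.1 x hx
    obtain ⟨z, hz, rfl⟩ := notP hcon.2 y hy
    exact mem_span_singleton_mul.mpr ⟨z, hz, by ring⟩
  obtain ⟨i, hi, hi0⟩ := Submodule.exists_mem_ne_zero_of_ne_bot h0
  have hIP : I ≤ P := fun a ha => by
    by_cases ha0 : a = 0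
    · exact ha0 ▸ P.zero_mem
    · exact hlt ha0 ha
  have hP2 : ¬ P ≤ P * P := fun hle =>
    hi0 (by simpa [hA P hP (le_antisymm Ideal.mul_le_right hle)] using hIP hi)
  obtain ⟨p, hp, hpP⟩ := SetLike.not_le_iff_exists.mp hP2
  obtain ⟨x, hx, hxp⟩ := SetLike.not_le_iff_exists.mp ((memP p).mp hp)
  -- Such a cofactor `c` satisfies `cI = I`, so it can be divided out within `I`.
  have hcof : ∀ {b c}, b ∈ P → b * c = p → c ∉ P := fun hb hbc hc =>
    hpP (hbc ▸ mul_mem_mul hb hc)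
  obtain ⟨y, rfl⟩ | ⟨c, hc⟩ := ValuationRing.dvd_total p x
  · have hy0 : y ≠ 0 := by
      rintro rfl
      exact hxp (by simp)
    have hyI : y ∉ I := fun h => hxp (mul_mem_mul (mem_span_singleton_self p) h)
    refine ⟨y, P, hy0, hP, le_antisymm (fun z hz => ?_) (span_singleton_mul_le_iff.mpr ?_)⟩
    · obtain ⟨a, rfl⟩ | ⟨w, hw⟩ := ValuationRing.dvd_total y z
      · refine mul_mem_mul (mem_span_singleton_self y) ?_
        by_contra ha
        obtain ⟨z', hz', h⟩ := notP ha _ hz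
        by_cases ha0 : a = 0
        · exact ha (ha0 ▸ P.zero_mem)
        · exact hyI (mul_left_cancel₀ ha0 (h.trans (mul_comm y a)) ▸ hz')
      · exact absurd (hw ▸ I.mul_mem_right w hz) hyI
    · intro b hb
      obtain ⟨d, rfl⟩ | ⟨d, hd⟩ := ValuationRing.dvd_total p b
      · rw [show y * (p * d) = d * (p * y) by ring]
        exact I.mul_mem_left _ hx
      · obtain ⟨x', hx', h⟩ := notP (hcof hb hd.symm) _ hx
        have hd0 : d ≠ 0 := fun h0 => hcof hb hd.symm (h0 ▸ P.zero_mem)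
        have : x' = y * b := mul_left_cancel₀ hd0 (by rw [h, hd]; ring)
        exact this ▸ hx'
  · refine ⟨1, P, one_ne_zero, hP, ?_⟩
    rw [span_singleton_one, top_mul]
    refine le_antisymm hIP fun b hb => ?_
    have hpI : p ∈ I := hc ▸ I.mul_mem_right c hx
    obtain ⟨d, rfl⟩ | ⟨d, hd⟩ := ValuationRing.dvd_total p b
    · exact I.mul_mem_right d hpI
    · have hdP := hcof hb hd.symm
      obtain ⟨x', hx', h⟩ := notP hdP _ hpI
      have hd0 : d ≠ 0 := fun h0 => hdP (h0 ▸ P.zero_mem)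
      exact mul_left_cancel₀ hd0 (h.trans (hd.trans (mul_comm b d))) ▸ hx'

theorem IsStronglyDiscrete.isISPDomain {A : Type*} [CommRing A] [IsDomain A] [ValuationRing A]
    (hA : IsStronglyDiscrete A) : IsISPDomain A := by
  intro I h0 h1
  obtain ⟨y, P, hy, hP, h⟩ := ValuationRing.exists_eq_span_singleton_mul_prime hA h0 h1
  refine ⟨span {y}, [P], isInvertibleIdeal_span_singleton hy, List.cons_ne_nil _ _, ?_, by simpa⟩
  simpa using ⟨hP.ne_top, hP.isRadical⟩

theorem theorem2p1 (A : Type*) [CommRing A] [IsDomain A] :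
    (IsISPDomain A →
      (IsPruferDomain A ∧ IsStronglyDiscrete A) ∧
      (∀ P : Ideal A, P.IsPrime → P ≠ ⊥ → ∃! M : Ideal A, M.IsMaximal ∧ P ≤ M)) ∧
    (IsLocalRing A → (IsISPDomain A ↔ ValuationRing A ∧ IsStronglyDiscrete A)) := by
  refine ⟨fun hA => ⟨⟨hA.isPruferDomain, hA.isStronglyDiscrete⟩, fun P hP hP0 => ?_⟩,
    fun _ => ⟨fun hA => ⟨hA.valuationRing, hA.isStronglyDiscrete⟩, fun ⟨_, hA⟩ => hA.isISPDomain⟩⟩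
  obtain ⟨M, hM, hPM⟩ := exists_le_maximal P hP.ne_top
  refine ⟨M, ⟨hM, hPM⟩, fun N ⟨hN, hPN⟩ => ?_⟩
  obtain h | h := hA.le_of_prime_le hP hP0 hN.isPrime hM.isPrime hPN hPM
  · exact hN.eq_of_le hM.ne_top h
  · exact (hM.eq_of_le hN.ne_top h).symm
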